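/- All algebras and linear maps are over $\mathbb C$. For a bounded linear map $T:A\to B$ between Banach algebras let $S_T(a,b)=T(a)T(b)-T(ab)$. A linear map between normed spaces is \emph{weakly compact} if the weak closure of the image of the open unit ball is weakly compact. A \emph{bounded semi-wcf-isomorphism} is a bijective bounded linear map $T:A\to B$ such that, for every $a\in A$, the linear maps $S_T(a,\cdot)$ and $S_T(\cdot,a)$ are weakly compact. A \emph{bounded $1$df-isomorphism} is a bijective bounded linear map $T:A\to B$ such that the linear span of $S_T(A\times A)$ has dimension at most $1$. A map $T:C_0(X)\to C_0(X)$ \emph{preserves nowhere-zero functions} if $T(f)$ has no zeros whenever $f\in C_0(X)$ has no zeros. A topological space is \emph{perfect} if it is non-empty and has no isolated points. Let $X$ be an infinite, locally compact Hausdorff space, and consider the following conditions: (a) every bounded semi-wcf-isomorphism $T:C_0(X)\to C_0(X)$ is multiplicative; (b) every bounded $1$df-isomorphism $T:C_0(X)\to C_0(X)$ preserves nowhere-zero functions; (c) $X$ is perfect. Then (a) and (c) are equivalent, and (a) implies (b). If $X$ is moreover $\sigma$-compact (for locally compact Hausdorff $X$, this says precisely that $C_0(X)$ contains a function without zeros),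 then (a), (b) and (c) are all equivalent. -/

import Mathlib

open scoped ZeroAtInfty

noncomputable section

namespace CloseToMultiplicative

section Algebra

variable {A B : Type*}
  [NonUnitalNormedRing A] [NormedSpace ℂ A] [IsScalarTower ℂ A A] [SMulCommClass ℂ A A]
  [NonUnitalNormedRing B] [NormedSpace ℂ B] [IsScalarTower ℂ B B] [SMulCommClass ℂ B B]

/-- The failure of multiplicativity of a linear map `T`, as a bilinear map:
`(a, b) ↦ T a * T b - T (a * b)`. -/
def failure (T : A →L[ℂ] B) : A →ₗ[ℂ] A →ₗ[ℂ] B :=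
  LinearMap.mk₂ ℂ (fun a b => T a * T b - T (a * b))
    (fun a a' b => by simp only [map_add, add_mul]; abel)
    (fun c a b => by simp only [map_smul, smul_mul_assoc, smul_sub])
    (fun a b b' => by simp only [map_add, mul_add]; abel)
    (fun c a b => by simp only [map_smul, mul_smul_comm, smul_sub])

/-- A linear map between normed spaces is weakly compact if the weak closure of the image of the
open unit ball is weakly compact. -/
def IsWeaklyCompactMap {E F : Type*} [NormedAddCommGroup E] [NormedSpace ℂ E]
    [NormedAddCommGroup F] [NormedSpace ℂ F] (S : E →ₗ[ℂ] F) : Prop :=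
  IsCompact (closure (toWeakSpace ℂ F '' (S '' Metric.ball (0 : E) 1)))

/-- `T` is a semi-wcf-homomorphism: the failure of multiplicativity of `T` is weakly compact in
each variable separately. -/
def IsSemiWcfHom (T : A →L[ℂ] B) : Prop :=
  ∀ a : A, IsWeaklyCompactMap (failure T a) ∧ IsWeaklyCompactMap ((failure T).flip a)

/-- `T` is an `n`df-homomorphism: the values of the failure of multiplicativity of `T` span a
subspace of dimension at most `n`. -/
def IsNdfHom (n : ℕ) (T : A →L[ℂ] B) : Prop :=
  Module.rank ℂ (Submodule.span ℂ (Set.range fun p : A × A => failure T p.1 p.2)) ≤ n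

/-- A bounded semi-wcf-isomorphism: a bijective bounded semi-wcf-homomorphism. -/
def IsSemiWcfIso (T : A →L[ℂ] B) : Prop :=
  IsSemiWcfHom T ∧ Function.Bijective T

/-- A bounded `n`df-isomorphism: a bijective bounded `n`df-homomorphism. -/
def IsNdfIso (n : ℕ) (T : A →L[ℂ] B) : Prop :=
  IsNdfHom n T ∧ Function.Bijective T

/-- `T` is multiplicative. -/
def IsMultiplicative (T : A →L[ℂ] B) : Prop :=
  ∀ a b : A, T (a * b) = T a * T b

end Algebra

/-- `f` has no zeros. -/
def NowhereZero {X : Type*} [TopologicalSpace X] (f : C₀(X, ℂ)) : Prop :=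
  ∀ x : X, f x ≠ 0

/-- `T` maps nowhere-zero functions to nowhere-zero functions. -/
def PreservesNowhereZero {X Y : Type*} [TopologicalSpace X] [TopologicalSpace Y]
    (T : C₀(X, ℂ) →L[ℂ] C₀(Y, ℂ)) : Prop :=
  ∀ f : C₀(X, ℂ), NowhereZero f → NowhereZero (T f)

/-- A topological space is perfect if it is non-empty and has no isolated points. -/
def IsPerfectSpace (X : Type*) [TopologicalSpace X] : Prop :=
  Nonempty X ∧ ∀ x : X, ¬ IsOpen ({x} : Set X)

end CloseToMultiplicative

end

open CloseToMultiplicative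

/-! Write S for `failure T`. By `failure_mul_apply`, c ↦ S(a,b)T(c) is a combination of weakly
compact maps. As T has a bounded inverse, multiplication by S(a,b) is weakly compact too. Bumps at x
that vanish on ever larger finite sets tend pointwise to the indicator of {x}, so S(a,b)(x) times
that indicator is continuous. If x is not isolated, S(a,b)(x) = 0; hence (c) gives (a). Conversely,
let d be the indicator of an isolated point. The maps f ↦ f + φ(f)d are `1`df-isomorphisms when φ(d)
≠ -1, and suitable φ refute (a) and (b). Finally, (a) gives (b) because finite-dimensional failure
is weakly compact and a surjective multiplicative T preserves nowhere-zero functions. -/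

open Filter Topology

namespace CloseToMultiplicative

/-! ### Weakly compact maps -/

section WeaklyCompact

variable {E F : Type*} [NormedAddCommGroup E] [NormedSpace ℂ E]
  [NormedAddCommGroup F] [NormedSpace ℂ F]

/-- A bounded linear map of finite rank is weakly compact. -/
theorem isWeaklyCompactMap_of_finiteDimensional (S : E →ₗ[ℂ] F) (C : ℝ)
    (hC : ∀ x, ‖S x‖ ≤ C * ‖x‖) (V : Submodule ℂ F) [FiniteDimensional ℂ V]
    (hV : ∀ x, S x ∈ V) : IsWeaklyCompactMap S := by
  have : ProperSpace V := FiniteDimensional.proper ℂ V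
  have hK : IsCompact (toWeakSpaceCLM ℂ F '' (V.subtypeL '' Metric.closedBall (0 : V) |C|)) :=
    ((isCompact_closedBall _ _).image V.subtypeL.continuous).image (toWeakSpaceCLM ℂ F).continuous
  refine hK.closure_of_subset ?_
  rintro _ ⟨_, ⟨x, hx, rfl⟩, rfl⟩
  refine ⟨S x, ⟨⟨S x, hV x⟩, ?_, rfl⟩, rfl⟩
  rw [mem_ball_zero_iff] at hx
  rw [mem_closedBall_zero_iff]
  calc ‖S x‖ ≤ C * ‖x‖ := hC x
    _ ≤ |C| * ‖x‖ := by gcongr; exact le_abs_self C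
    _ ≤ |C| * 1 := by gcongr
    _ = |C| := mul_one _

/-- Along an ultrafilter, the image of a bounded family under a weakly compact map converges
weakly. -/
theorem IsWeaklyCompactMap.exists_tendsto {S : E →ₗ[ℂ] F} (hS : IsWeaklyCompactMap S)
    {ι : Type*} (U : Ultrafilter ι) (c : ι → E) (R : ℝ) (hc : ∀ i, ‖c i‖ ≤ R) :
    ∃ v : F, ∀ φ : F →L[ℂ] ℂ, Tendsto (fun i => φ (S (c i))) U (𝓝 (φ v)) := by
  have hR : 0 < |R| + 1 := by positivity
  -- The `+ 1` makes the rescaled family land in the open unit ball.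
  set r : ℂ := ((|R| + 1 : ℝ) : ℂ) with hr
  have hr0 : r ≠ 0 := by rw [hr]; exact_mod_cast hR.ne'
  have hball : ∀ i, r⁻¹ • c i ∈ Metric.ball (0 : E) 1 := fun i => by
    rw [mem_ball_zero_iff, norm_smul, norm_inv, hr, Complex.norm_real, Real.norm_of_nonneg hR.le,
      inv_mul_lt_iff₀ hR, mul_one]
    linarith [hc i, le_abs_self R]
  obtain ⟨w, -, hw⟩ := isCompact_iff_ultrafilter_le_nhds.1 hS
    (U.map fun i => toWeakSpace ℂ F (S (r⁻¹ • c i))) (by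
      rw [le_principal_iff]
      exact Filter.mem_map.2 (Eventually.of_forall fun i =>
        subset_closure ⟨_, ⟨_, hball i, rfl⟩, rfl⟩))
  refine ⟨r • (toWeakSpace ℂ F).symm w, fun φ => ?_⟩
  have hcont : Continuous fun z : WeakSpace ℂ F => φ ((toWeakSpace ℂ F).symm z) :=
    WeakBilin.eval_continuous (topDualPairing ℂ F).flip φ
  have hlim : Tendsto (fun i => φ (S (r⁻¹ • c i))) U (𝓝 (φ ((toWeakSpace ℂ F).symm w))) :=
    (hcont.tendsto w).comp hw
  have := hlim.const_mul r
  simpa [hr0] using this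

end WeaklyCompact

/-! ### The failure of multiplicativity -/

section Failure

variable {A B : Type*}
  [NonUnitalNormedRing A] [NormedSpace ℂ A] [IsScalarTower ℂ A A] [SMulCommClass ℂ A A]
  [NonUnitalNormedRing B] [NormedSpace ℂ B] [IsScalarTower ℂ B B] [SMulCommClass ℂ B B]

@[simp]
theorem failure_apply (T : A →L[ℂ] B) (a b : A) : failure T a b = T a * T b - T (a * b) := rfl

theorem norm_failure_le (T : A →L[ℂ] B) (a b : A) :
    ‖failure T a b‖ ≤ (‖T‖ * ‖T‖ + ‖T‖) * (‖a‖ * ‖b‖) := by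
  rw [failure_apply]
  have h₁ : ‖T a * T b‖ ≤ (‖T‖ * ‖a‖) * (‖T‖ * ‖b‖) :=
    (norm_mul_le _ _).trans (mul_le_mul (T.le_opNorm a) (T.le_opNorm b) (norm_nonneg _)
      (by positivity))
  have h₂ : ‖T (a * b)‖ ≤ ‖T‖ * (‖a‖ * ‖b‖) :=
    (T.le_opNorm _).trans (by gcongr; exact norm_mul_le a b)
  calc _ ≤ ‖T a * T b‖ + ‖T (a * b)‖ := norm_sub_le _ _
    _ ≤ (‖T‖ * ‖a‖) * (‖T‖ * ‖b‖) + ‖T‖ * (‖a‖ * ‖b‖) := add_le_add h₁ h₂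
    _ = _ := by ring

theorem IsNdfHom.isSemiWcfHom {n : ℕ} {T : A →L[ℂ] B} (hT : IsNdfHom n T) : IsSemiWcfHom T := by
  set V := Submodule.span ℂ (Set.range fun p : A × A => failure T p.1 p.2) with hV
  have : FiniteDimensional ℂ V :=
    Module.rank_lt_aleph0_iff.1 (lt_of_le_of_lt hT Cardinal.natCast_lt_aleph0)
  have hmem : ∀ a b, failure T a b ∈ V := fun a b => Submodule.subset_span ⟨(a, b), rfl⟩
  refine fun a => ⟨?_, ?_⟩
  · exact isWeaklyCompactMap_of_finiteDimensional _ ((‖T‖ * ‖T‖ + ‖T‖) * ‖a‖)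
      (fun b => (norm_failure_le T a b).trans_eq (by ring)) V (hmem a)
  · exact isWeaklyCompactMap_of_finiteDimensional _ ((‖T‖ * ‖T‖ + ‖T‖) * ‖a‖)
      (fun b => (norm_failure_le T b a).trans_eq (by ring)) V (fun b => hmem b a)

theorem IsNdfIso.isSemiWcfIso {n : ℕ} {T : A →L[ℂ] B} (hT : IsNdfIso n T) : IsSemiWcfIso T :=
  ⟨hT.1.isSemiWcfHom, hT.2⟩

/-- The cocycle identity for the failure of multiplicativity. -/
theorem failure_mul_apply (T : A →L[ℂ] B) (a b c : A) :
    failure T a b * T c = T a * failure T b c + failure T a (b * c) - failure T (a * b) c := by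
  simp only [failure_apply, sub_mul, mul_sub, mul_assoc]
  abel

end Failure

/-! ### Function theory on `C₀(X, ℂ)`, and the implications -/

section ZeroAtInfty

variable {X : Type*} [TopologicalSpace X]

theorem norm_apply_le (f : C₀(X, ℂ)) (x : X) : ‖f x‖ ≤ ‖f‖ := by
  rw [← ZeroAtInftyContinuousMap.norm_toBCF_eq_norm]
  exact f.toBCF.norm_coe_le_norm x

theorem norm_le_of_forall {f : C₀(X, ℂ)} {C : ℝ} (hC : 0 ≤ C) (h : ∀ x, ‖f x‖ ≤ C) : ‖f‖ ≤ C := by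
  rw [← ZeroAtInftyContinuousMap.norm_toBCF_eq_norm]
  exact (BoundedContinuousFunction.norm_le hC).2 h

/-- Evaluation at a point, as a continuous linear functional. -/
noncomputable def evalCLM (x : X) : C₀(X, ℂ) →L[ℂ] ℂ :=
  LinearMap.mkContinuous
    { toFun := fun f => f x
      map_add' := fun _ _ => rfl
      map_smul' := fun _ _ => rfl } 1
    (fun f => by simpa using norm_apply_le f x)

@[simp]
theorem evalCLM_apply (x : X) (f : C₀(X, ℂ)) : evalCLM x f = f x := rfl

/-- A compactly supported continuous function, as an element of `C₀(X, ℂ)`. -/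
def ofCompactSupport (f : X → ℂ) (hf : Continuous f) (hc : HasCompactSupport f) : C₀(X, ℂ) where
  toFun := f
  continuous_toFun := hf
  zero_at_infty' := hc.is_zero_at_infty

@[simp]
theorem ofCompactSupport_apply (f : X → ℂ) (hf : Continuous f) (hc : HasCompactSupport f) (x : X) :
    ofCompactSupport f hf hc x = f x := rfl

/-- Urysohn's lemma in `C₀(X, ℂ)`. -/
theorem exists_bump [LocallyCompactSpace X] [T2Space X] {K C : Set X} (hK : IsCompact K)
    (hC : IsClosed C) (hd : Disjoint K C) :
    ∃ φ : C₀(X, ℂ), (∀ x ∈ K, φ x = 1) ∧ (∀ x ∈ C, φ x = 0) ∧ HasCompactSupport φ ∧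
      ∀ x, ∃ r ∈ Set.Icc (0 : ℝ) 1, φ x = r := by
  obtain ⟨f, h1, h0, hc, hI⟩ := exists_continuous_one_zero_of_isCompact hK hC hd
  have hc' : HasCompactSupport fun x => (f x : ℂ) :=
    hc.comp_left (g := ((↑) : ℝ → ℂ)) Complex.ofReal_zero
  refine ⟨ofCompactSupport (fun x => (f x : ℂ)) (by fun_prop) hc', fun x hx => ?_, fun x hx => ?_,
    hc', fun x => ⟨f x, hI x, rfl⟩⟩
  · simp [h1 hx]
  · simp [h0 hx]

theorem norm_le_one_of_Icc {φ : C₀(X, ℂ)} (h : ∀ x, ∃ r ∈ Set.Icc (0 : ℝ) 1, φ x = r) :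
    ‖φ‖ ≤ 1 := by
  refine norm_le_of_forall zero_le_one fun x => ?_
  obtain ⟨r, hr, hx⟩ := h x
  rw [hx, Complex.norm_real, Real.norm_of_nonneg hr.1]
  exact hr.2

/-- On a σ-compact locally compact Hausdorff space there is a function in `C₀` without zeros. -/
theorem exists_nowhereZero [LocallyCompactSpace X] [T2Space X] [SigmaCompactSpace X] :
    ∃ f : C₀(X, ℂ), NowhereZero f := by
  have h := fun n => exists_bump (isCompact_compactCovering X n) isClosed_empty
    (Set.disjoint_empty _)
  choose φ h1 _ _ hI using h
  choose r hr hφ using hI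
  have hsum : Summable fun n => ((1 / 2 : ℂ) ^ n) • φ n := by
    refine Summable.of_norm_bounded summable_geometric_two fun n => ?_
    rw [norm_smul, norm_pow]
    have := norm_le_one_of_Icc fun x => ⟨r n x, hr n x, hφ n x⟩
    have h2 : ‖(1 / 2 : ℂ)‖ = 1 / 2 := by norm_num
    rw [h2]
    exact mul_le_of_le_one_right (by positivity) this
  refine ⟨∑' n, ((1 / 2 : ℂ) ^ n) • φ n, fun x hx => ?_⟩
  have hs : HasSum (fun n => evalCLM x (((1 / 2 : ℂ) ^ n) • φ n)) 0 := by
    have := hsum.hasSum.mapL (evalCLM x)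
    rwa [evalCLM_apply, hx] at this
  have hterm : ∀ n, evalCLM x (((1 / 2 : ℂ) ^ n) • φ n) = (((1 / 2 : ℝ) ^ n * r n x : ℝ) : ℂ) := by
    intro n
    rw [map_smul, evalCLM_apply, hφ, smul_eq_mul]
    push_cast
    rfl
  simp only [hterm] at hs
  replace hs : HasSum (fun n => (1 / 2 : ℝ) ^ n * r n x) 0 := by
    rwa [← Complex.ofReal_zero, Complex.hasSum_ofReal] at hs
  have hz := (hasSum_zero_iff_of_nonneg fun n => mul_nonneg (by positivity) (hr n x).1).1 hs
  obtain ⟨n, hn⟩ := exists_mem_compactCovering x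
  have hrn : r n x = 1 := by
    have := (hφ n x).symm.trans (h1 n x hn)
    exact_mod_cast this
  have := congrFun hz n
  simp [hrn] at this

/-- On a perfect space every bounded semi-wcf-isomorphism is multiplicative. -/
theorem IsSemiWcfIso.isMultiplicative [LocallyCompactSpace X] [T2Space X]
    (hX : IsPerfectSpace X) {T : C₀(X, ℂ) →L[ℂ] C₀(X, ℂ)} (hT : IsSemiWcfIso T) :
    IsMultiplicative T := by
  intro a b
  suffices h : failure T a b = 0 from (sub_eq_zero.1 h).symm
  ext x
  -- The open mapping theorem bounds the preimages of the bumps.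
  let e : C₀(X, ℂ) ≃L[ℂ] C₀(X, ℂ) := ContinuousLinearEquiv.ofBijective T
    (LinearMap.ker_eq_bot.2 hT.2.1) (LinearMap.range_eq_top.2 hT.2.2)
  have hbump : ∀ s : Finset X, ∃ φ : C₀(X, ℂ), φ x = 1 ∧ (∀ y ∈ s, y ≠ x → φ y = 0) ∧ ‖φ‖ ≤ 1 := by
    intro s
    obtain ⟨φ, h1, h0, -, hI⟩ := exists_bump (isCompact_singleton (x := x))
      ((s.finite_toSet.subset Set.sdiff_subset).isClosed (s := (s : Set X) \ {x}))
      Set.disjoint_sdiff_right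
    exact ⟨φ, h1 x rfl, fun y hy hyx => h0 y ⟨hy, hyx⟩, norm_le_one_of_Icc hI⟩
  choose φ hφ1 hφ0 hφn using hbump
  let c : Finset X → C₀(X, ℂ) := fun s => e.symm (φ s)
  have hTc : ∀ s, T (c s) = φ s := fun s => e.apply_symm_apply (φ s)
  have hc : ∀ s, ‖c s‖ ≤ ‖(e.symm : C₀(X, ℂ) →L[ℂ] C₀(X, ℂ))‖ := fun s =>
    ((e.symm : C₀(X, ℂ) →L[ℂ] C₀(X, ℂ)).le_opNorm (φ s)).trans
      (mul_le_of_le_one_right (norm_nonneg _) (hφn s))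
  have hbc : ∀ s, ‖b * c s‖ ≤ ‖b‖ * ‖(e.symm : C₀(X, ℂ) →L[ℂ] C₀(X, ℂ))‖ := fun s =>
    (norm_mul_le _ _).trans (by gcongr; exact hc s)
  -- One ultrafilter finer than `atTop` makes all three weak limits below exist at once.
  let U : Ultrafilter (Finset X) := Ultrafilter.of atTop
  have hU : (U : Filter (Finset X)) ≤ atTop := Ultrafilter.of_le _
  obtain ⟨v₁, hv₁⟩ := (hT.1 b).1.exists_tendsto U c _ hc
  obtain ⟨v₂, hv₂⟩ := (hT.1 a).1.exists_tendsto U (fun s => b * c s) _ hbc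
  obtain ⟨v₃, hv₃⟩ := (hT.1 (a * b)).1.exists_tendsto U c _ hc
  set h : C₀(X, ℂ) := T a * v₁ + v₂ - v₃
  have hlim : ∀ y, Tendsto (fun s => failure T a b y * φ s y) U (𝓝 (h y)) := by
    intro y
    have := (((hv₁ (evalCLM y)).const_mul (T a y)).add (hv₂ (evalCLM y))).sub (hv₃ (evalCLM y))
    refine this.congr fun s => ?_
    have := congrArg (fun f : C₀(X, ℂ) => f y) (failure_mul_apply T a b (c s))
    rw [hTc] at this
    exact this.symm
  have hx : h x = failure T a b x :=
    tendsto_nhds_unique (hlim x) (by simp only [hφ1, mul_one]; exact tendsto_const_nhds)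
  have hne : ∀ y ≠ x, h y = 0 := by
    intro y hy
    refine tendsto_nhds_unique (hlim y) (tendsto_const_nhds.congr' ?_)
    filter_upwards [hU (eventually_ge_atTop {y})] with s hs
    rw [hφ0 s y (hs (Finset.mem_singleton_self y)) hy, mul_zero]
  rw [← hx]
  have : (𝓝[≠] x).NeBot := by
    rw [neBot_iff, Ne, ← isOpen_singleton_iff_punctured_nhds]
    exact hX.2 x
  refine tendsto_nhds_unique (l := 𝓝[≠] x) ((h.continuous.tendsto x).mono_left nhdsWithin_le_nhds)
    (tendsto_const_nhds.congr' ?_)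
  filter_upwards [self_mem_nhdsWithin] with y hy
  exact (hne y hy).symm

/-- A surjective bounded multiplicative map preserves nowhere-zero functions. -/
theorem IsMultiplicative.preservesNowhereZero [LocallyCompactSpace X] [T2Space X]
    {T : C₀(X, ℂ) →L[ℂ] C₀(X, ℂ)} (hT : IsMultiplicative T) (hs : Function.Surjective T) :
    PreservesNowhereZero T := by
  intro f hf x hx
  -- If `T f` vanishes at `x`, so does T on the ideal generated by `f`, which is dense; this
  -- contradicts surjectivity.
  have hzero : ∀ g, T g x = 0 := by
    intro g
    refine norm_le_zero_iff.1 (le_of_forall_pos_le_add fun ε hε => ?_)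
    set δ := ε / (‖T‖ + 1) with hδ
    have hδ0 : 0 < δ := by positivity
    obtain ⟨K, hK, hKg⟩ := mem_cocompact.1 (g.zero_at_infty' (Metric.ball_mem_nhds 0 hδ0))
    obtain ⟨κ, h1, -, hc, hI⟩ := exists_bump hK isClosed_empty (Set.disjoint_empty _)
    -- The quotient `g / f` need not vanish at infinity, hence the cutoff `κ`.
    have hκ : HasCompactSupport fun y => κ y * (g y / f y) := hc.mul_right
    let q : C₀(X, ℂ) := ofCompactSupport (fun y => κ y * (g y / f y))
      (κ.continuous.mul (g.continuous.div f.continuous hf)) hκ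
    have hfq : f * q = κ * g := by
      ext y
      have := hf y
      simp only [ZeroAtInftyContinuousMap.mul_apply, q, ofCompactSupport_apply]
      field_simp
    have hTq : T (κ * g) x = 0 := by
      rw [← hfq, hT, ZeroAtInftyContinuousMap.mul_apply, hx, zero_mul]
    have hsmall : ‖g - κ * g‖ ≤ δ := by
      refine norm_le_of_forall hδ0.le fun y => ?_
      obtain ⟨r, hr, hy⟩ := hI y
      by_cases hyK : y ∈ K
      · simp [h1 y hyK, hδ0.le]
      · have hgy : ‖g y‖ < δ := mem_ball_zero_iff.1 (hKg hyK)
        have heq : (g - κ * g) y = ((1 - r : ℝ) : ℂ) * g y := by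
          simp only [ZeroAtInftyContinuousMap.sub_apply, ZeroAtInftyContinuousMap.mul_apply, hy]
          push_cast
          ring
        rw [heq, norm_mul, Complex.norm_real, Real.norm_of_nonneg (by linarith [hr.2])]
        nlinarith [norm_nonneg (g y), hr.1]
    calc ‖T g x‖ = ‖T (g - κ * g) x‖ := by
          rw [map_sub, ZeroAtInftyContinuousMap.sub_apply, hTq, sub_zero]
      _ ≤ ‖T (g - κ * g)‖ := norm_apply_le _ _
      _ ≤ ‖T‖ * δ := (T.le_opNorm _).trans (by gcongr)
      _ ≤ (‖T‖ + 1) * δ := by gcongr; linarith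
      _ = 0 + ε := by rw [hδ, zero_add]; field_simp
  obtain ⟨φ, h1, -⟩ := exists_bump (isCompact_singleton (x := x)) isClosed_empty
    (Set.disjoint_empty _)
  obtain ⟨g, hg⟩ := hs φ
  have := hzero g
  rw [hg, h1 x rfl] at this
  exact one_ne_zero this

/-- The indicator function of an isolated point lies in `C₀(X, ℂ)`. -/
theorem exists_indicator [T2Space X] [LocallyCompactSpace X] {x : X}
    (hx : IsOpen ({x} : Set X)) :
    ∃ d : C₀(X, ℂ), d x = 1 ∧ ∀ y ≠ x, d y = 0 := by
  obtain ⟨d, h1, h0, -⟩ := exists_bump (isCompact_singleton (x := x)) hx.isClosed_compl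
    disjoint_compl_right
  exact ⟨d, h1 x rfl, h0⟩

/-- If `d` is the indicator function of an isolated point, then `f ↦ f + φ(f) d` is a
`1`df-isomorphism as soon as it is injective on the span of `d`. -/
theorem isNdfIso_id_add_smulRight {x : X} {d : C₀(X, ℂ)} (h1 : d x = 1) (h0 : ∀ y ≠ x, d y = 0)
    (φ : C₀(X, ℂ) →L[ℂ] ℂ) (hφ : 1 + φ d ≠ 0) :
    IsNdfIso 1 (ContinuousLinearMap.id ℂ C₀(X, ℂ) + φ.smulRight d) := by
  refine ⟨?_, ?_⟩
  · have hle : Submodule.span ℂ (Set.range fun p : C₀(X, ℂ) × C₀(X, ℂ) =>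
        failure (ContinuousLinearMap.id ℂ C₀(X, ℂ) + φ.smulRight d) p.1 p.2) ≤
        Submodule.span ℂ {d} := by
      rw [Submodule.span_le]
      rintro _ ⟨⟨f, g⟩, rfl⟩
      refine Submodule.mem_span_singleton.2
        -- Off `x` the map does not change values, so its failure vanishes there.
        ⟨failure (ContinuousLinearMap.id ℂ C₀(X, ℂ) + φ.smulRight d) f g x, ?_⟩
      ext y
      by_cases hy : y = x
      · subst hy
        simp [h1]
      · simp [h0 y hy]
    exact (Submodule.rank_mono hle).trans ((rank_span_le _).trans (by simp))
  · rw [Function.bijective_iff_has_inverse]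
    -- Applying `φ` to g = f + φ(f)d gives φ(g) = φ(f)(1 + φ(d)), which determines f.
    refine ⟨fun g => g - (φ g / (1 + φ d)) • d, fun f => ?_, fun g => ?_⟩
    · have : (φ f + φ f * φ d) / (1 + φ d) = φ f := by field_simp
      simp [this]
    · have : φ g - φ g / (1 + φ d) * φ d = φ g / (1 + φ d) := by field_simp; ring
      simp [this]

theorem isPerfectSpace_of_isMultiplicative [LocallyCompactSpace X] [T2Space X] [Nonempty X]
    (h : ∀ T : C₀(X, ℂ) →L[ℂ] C₀(X, ℂ), IsSemiWcfIso T → IsMultiplicative T) :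
    IsPerfectSpace X := by
  refine ⟨inferInstance, fun x hx => ?_⟩
  obtain ⟨d, h1, h0⟩ := exists_indicator hx
  have hT := h _ (isNdfIso_id_add_smulRight h1 h0 (evalCLM x) (by norm_num [h1])).isSemiWcfIso
  -- Here T(d) = 2d and d² = d, so multiplicativity at `x` would say 2 = 4.
  have := congrArg (fun f : C₀(X, ℂ) => f x) (hT d d)
  norm_num [h1] at this

theorem isPerfectSpace_of_preservesNowhereZero [LocallyCompactSpace X] [T2Space X] [Nontrivial X]
    [SigmaCompactSpace X]
    (h : ∀ T : C₀(X, ℂ) →L[ℂ] C₀(X, ℂ), IsNdfIso 1 T → PreservesNowhereZero T) :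
    IsPerfectSpace X := by
  refine ⟨inferInstance, fun x hx => ?_⟩
  obtain ⟨d, h1, h0⟩ := exists_indicator hx
  obtain ⟨f, hf⟩ := exists_nowhereZero (X := X)
  obtain ⟨y, hy⟩ := exists_ne x
  -- The scalar is chosen so that T(f)(x) = f(x) - (f(x)/f(y))f(y) = 0; the functional kills `d`
  -- since y ≠ x.
  have hT := h _ (isNdfIso_id_add_smulRight h1 h0 (-(f x / f y) • evalCLM y) (by simp [h0 y hy]))
  refine hT f hf x ?_
  have := hf y
  simp [h1, this]

end ZeroAtInfty

end CloseToMultiplicative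

theorem mainTheorem3 (X : Type*) [TopologicalSpace X] [LocallyCompactSpace X] [T2Space X]
    [Infinite X] :
    ((∀ T : C₀(X, ℂ) →L[ℂ] C₀(X, ℂ), IsSemiWcfIso T → IsMultiplicative T) ↔
      IsPerfectSpace X) ∧
    ((∀ T : C₀(X, ℂ) →L[ℂ] C₀(X, ℂ), IsSemiWcfIso T → IsMultiplicative T) →
      ∀ T : C₀(X, ℂ) →L[ℂ] C₀(X, ℂ), IsNdfIso 1 T → PreservesNowhereZero T) ∧
    (SigmaCompactSpace X →
      List.TFAE
        [∀ T : C₀(X, ℂ) →L[ℂ] C₀(X, ℂ), IsSemiWcfIso T → IsMultiplicative T,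
         ∀ T : C₀(X, ℂ) →L[ℂ] C₀(X, ℂ), IsNdfIso 1 T → PreservesNowhereZero T,
         IsPerfectSpace X]) := by
  have hac : (∀ T : C₀(X, ℂ) →L[ℂ] C₀(X, ℂ), IsSemiWcfIso T → IsMultiplicative T) ↔
      IsPerfectSpace X :=
    ⟨isPerfectSpace_of_isMultiplicative, fun hX _ hT => hT.isMultiplicative hX⟩
  have hab : (∀ T : C₀(X, ℂ) →L[ℂ] C₀(X, ℂ), IsSemiWcfIso T → IsMultiplicative T) →
      ∀ T : C₀(X, ℂ) →L[ℂ] C₀(X, ℂ), IsNdfIso 1 T → PreservesNowhereZero T :=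
    fun h T hT => (h T hT.isSemiWcfIso).preservesNowhereZero hT.2.2
  refine ⟨hac, hab, fun _ => ?_⟩
  tfae_have 1 → 2 := hab
  tfae_have 2 → 3 := isPerfectSpace_of_preservesNowhereZero
  tfae_have 3 → 1 := hac.2
  tfae_finish
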